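/- Let $0<\alpha<1$, $\omega>0$, $t_0\in\mathbb R$, and put $s_\omega(t)=t_0$ for $t_0\le t\le t_0+\omega$ and $s_\omega(t)=t-\omega$ for $t>t_0+\omega$. The short memory fractional derivative of a scalar function $g$ is $$\tilde D^\alpha g(t)=\frac1{\Gamma(1-\alpha)}\int_{s_\omega(t)}^t (t-\tau)^{-\alpha}g'(\tau)\,d\tau ,$$ and it is taken componentwise for vector functions. Call $g$ admissible if it is absolutely continuous on $[t_0,T]$ for every $T\ge t_0$ and this integral converges absolutely for every $t>t_0$. Let $f:\mathbb R^n\times[t_0,\infty)\to\mathbb R^n$ be continuous with $f(0,t)=0$ for all $t\ge t_0$. A solution of the system $$\tilde D^\alpha x(t)=f(x(t),t)$$ is a function $x:[t_0,\infty)\to\mathbb R^n$ with admissible components that satisfies the equation for all $t>t_0$. Suppose that there are a function $V:[t_0,\infty)\times\mathbb R^n\to\mathbb R$, a constant $\lambda>0$ and continuous strictly increasing functions $\phi_1,\phi_2:[0,\infty)\to[0,\infty)$ with $\phi_1(0)=\phi_2(0)=0$ such that 1. $\phi_1(\|x\|)\le V(t,x)\le\phi_2(\|x\|)$ for all $t\ge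 t_0$ and $x\in\mathbb R^n$, where $\|\cdot\|$ is the Euclidean norm; 2. for every solution $x$, the function $v(t)=V(t,x(t))$ is admissible and $\tilde D^\alpha v(t)\le-\lambda v(t)$ for all $t>t_0$; 3. $\lambda>\dfrac{1}{\omega^\alpha\,\Gamma(1-\alpha)}$. Then the equilibrium $0$ is Lyapunov asymptotically stable: for every $\varepsilon>0$ there is $\delta>0$ such that every solution with $\|x(t_0)\|<\delta$ satisfies $\|x(t)\|<\varepsilon$ for all $t\ge t_0$; and there is $\delta>0$ such that every solution with $\|x(t_0)\|<\delta$ satisfies $x(t)\to0$ as $t\to\infty$. -/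

import Mathlib

open MeasureTheory Filter Topology Set
open scoped NNReal

noncomputable section

namespace ShortMemory

/-- The lower terminal `s_ω(t)` of the memory window: `t₀` for `t₀ ≤ t ≤ t₀ + ω`, and `t - ω` for
`t > t₀ + ω`. -/
def lowerTerminal (t₀ ω t : ℝ) : ℝ := if t ≤ t₀ + ω then t₀ else t - ω

/-- The short memory fractional derivative of order `α` of a scalar function,
`(1 / Γ(1 - α)) ∫_{s_ω(t)}^t (t - τ)^{-α} g'(τ) dτ`. -/
def fracDeriv (α ω t₀ : ℝ) (g : ℝ → ℝ) (t : ℝ) : ℝ :=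
  1 / Real.Gamma (1 - α) * ∫ τ in (lowerTerminal t₀ ω t)..t, (t - τ) ^ (-α) * deriv g τ

/-- The scalar functions to which the operator `fracDeriv α ω t₀` is applied: `g` is locally
absolutely continuous on `[t₀, ∞)` and the integral defining the short memory derivative converges
absolutely at every time `t > t₀`. Every continuously differentiable function has this property,
but so do functions behaving like `(t - t₀) ^ α` at `t₀`, as solutions of fractional equations
do. -/
structure Admissible (α ω t₀ : ℝ) (g : ℝ → ℝ) : Prop where
  absCont : ∀ T, t₀ ≤ T → AbsolutelyContinuousOnInterval g t₀ T
  integrable : ∀ t, t₀ < t →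
    IntervalIntegrable (fun τ => (t - τ) ^ (-α) * deriv g τ) volume (lowerTerminal t₀ ω t) t

/-- `x` is a solution on `[t₀, ∞)` of the short memory system `D̃^α x = f(x, t)`, the derivative
being taken componentwise. (At `t = t₀` the integral defining the derivative is over a degenerate
interval, so the equation is imposed at the times `t > t₀`.) -/
structure IsSolution {n : ℕ} (α ω t₀ : ℝ)
    (f : EuclideanSpace ℝ (Fin n) → ℝ → EuclideanSpace ℝ (Fin n))
    (x : ℝ → EuclideanSpace ℝ (Fin n)) : Prop where
  admissible : ∀ i, Admissible α ω t₀ (fun t => x t i)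
  equation : ∀ t, t₀ < t → ∀ i, fracDeriv α ω t₀ (fun τ => x τ i) t = f (x t) t i

/-- `xs` is an equilibrium point of the system with right-hand side `f` on `[t₀, ∞)`. -/
def IsEquilibrium {n : ℕ} (t₀ : ℝ)
    (f : EuclideanSpace ℝ (Fin n) → ℝ → EuclideanSpace ℝ (Fin n))
    (xs : EuclideanSpace ℝ (Fin n)) : Prop :=
  ∀ t, t₀ ≤ t → f xs t = 0

/-- Lyapunov stability of the point `xs`. -/
def IsStable {n : ℕ} (α ω t₀ : ℝ)
    (f : EuclideanSpace ℝ (Fin n) → ℝ → EuclideanSpace ℝ (Fin n))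
    (xs : EuclideanSpace ℝ (Fin n)) : Prop :=
  ∀ ε > 0, ∃ δ > 0, ∀ x, IsSolution α ω t₀ f x → ‖x t₀ - xs‖ < δ →
    ∀ t, t₀ ≤ t → ‖x t - xs‖ < ε

/-- Local attractivity of the point `xs`. -/
def IsAttractive {n : ℕ} (α ω t₀ : ℝ)
    (f : EuclideanSpace ℝ (Fin n) → ℝ → EuclideanSpace ℝ (Fin n))
    (xs : EuclideanSpace ℝ (Fin n)) : Prop :=
  ∃ δ > 0, ∀ x, IsSolution α ω t₀ f x → ‖x t₀ - xs‖ < δ → Tendsto x atTop (𝓝 xs)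

/-- Lyapunov asymptotic stability: stability together with attractivity. -/
def IsAsymptoticallyStable {n : ℕ} (α ω t₀ : ℝ)
    (f : EuclideanSpace ℝ (Fin n) → ℝ → EuclideanSpace ℝ (Fin n))
    (xs : EuclideanSpace ℝ (Fin n)) : Prop :=
  IsStable α ω t₀ f xs ∧ IsAttractive α ω t₀ f xs

/-- Class-`K` functions `[0, ∞) → [0, ∞)`. -/
structure IsClassK (φ : ℝ≥0 → ℝ≥0) : Prop where
  continuous : Continuous φ
  strictMono : StrictMono φ
  map_zero : φ 0 = 0

end ShortMemory

end

open ShortMemory MeasureTheory Filter Topology Set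

/-! Along a solution, `v t = V t (x t)` stays below `u t = K * exp (-(μ * (t - t₀)))` whenever `K >
0` exceeds `v t₀`. At a first contact time `r`, `u - v` is nonnegative on the memory window and
vanishes at `r`; since the kernel increases towards `r`, integration by parts gives `D̃u r ≤ D̃v r ≤
-l * u r` (`integral_rpow_mul_deriv_le_of_touch`). But the window has length at most `ω`, so `D̃u ≥
-c(μ) * u` with `c(μ) → 0` as `μ → 0` (`le_fracDeriv_exp`); a `μ > 0` with `c(μ) < l` gives a
contradiction. The class-K bounds carry the exponential decay of `v` over to `x`. -/

/-- A nonnegative absolutely continuous function vanishing at the right end point of an interval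
has a nonpositive weighted integral of its derivative, for the weight `(t - τ) ^ (-α)`. -/
theorem integral_rpow_mul_deriv_nonpos {α s t : ℝ} {w : ℝ → ℝ} (hα : 0 ≤ α) (hst : s < t)
    (hw : AbsolutelyContinuousOnInterval w s t) (hw0 : ∀ τ ∈ Icc s t, 0 ≤ w τ) (hwt : w t = 0)
    (hint : IntervalIntegrable (fun τ => (t - τ) ^ (-α) * deriv w τ) volume s t) :
    ∫ τ in s..t, (t - τ) ^ (-α) * deriv w τ ≤ 0 := by
  have habs : IntervalIntegrable (fun τ => (t - τ) ^ (-α) * |deriv w τ|) volume s t := by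
    refine hint.abs.congr_ae ?_
    filter_upwards [ae_restrict_mem measurableSet_uIoc] with τ hτ
    rw [uIoc_of_le hst.le] at hτ
    simp only [abs_mul]
    rw [abs_of_nonneg (Real.rpow_nonneg (by linarith [hτ.2]) _)]
  -- The kernel may blow up at `t`, so parts are taken on `[s, c]` with `c < t`. The boundary term
  -- `(t - c) ^ (-α) * w c` is absorbed by the tail over `[c, t]`, because `w c = -∫ w'` there and
  -- the kernel is at least its value at `c`.
  have key : ∀ c ∈ Ico s t, ∫ τ in s..c, (t - τ) ^ (-α) * deriv w τ ≤
      (∫ τ in s..t, (t - τ) ^ (-α) * |deriv w τ|) -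
        ∫ τ in s..c, (t - τ) ^ (-α) * |deriv w τ| := by
    intro c hc
    have hcu : c ∈ uIcc s t := by rw [uIcc_of_le hst.le]; exact ⟨hc.1, hc.2.le⟩
    have hsc : uIcc s c ⊆ uIcc s t := uIcc_subset_uIcc_left hcu
    have hct : uIcc c t ⊆ uIcc s t := uIcc_subset_uIcc_right hcu
    have hkd : ∀ τ, τ < t → HasDerivAt (fun τ => (t - τ) ^ (-α)) (α * (t - τ) ^ (-α - 1)) τ := by
      intro τ hτ
      have h := ((hasDerivAt_id τ).const_sub t).rpow_const (p := -α)
        (Or.inl (by simpa using (sub_pos.2 hτ).ne'))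
      refine h.congr_deriv ?_
      simp only [id]
      ring
    have hkac : AbsolutelyContinuousOnInterval (fun τ => (t - τ) ^ (-α)) s c := by
      apply ContDiffOn.absolutelyContinuousOnInterval
      intro τ hτ
      rw [uIcc_of_le hc.1] at hτ
      have : t - τ ≠ 0 := by linarith [hτ.2, hc.2]
      exact ((contDiffAt_const.sub contDiffAt_id).rpow_const_of_ne this).contDiffWithinAt
    have hparts := hkac.integral_mul_deriv_eq_deriv_mul (hw.mono hsc)
    have h1 : 0 ≤ ∫ τ in s..c, deriv (fun τ => (t - τ) ^ (-α)) τ * w τ := by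
      refine intervalIntegral.integral_nonneg hc.1 fun τ hτ => ?_
      have hτt : τ < t := hτ.2.trans_lt hc.2
      rw [(hkd τ hτt).deriv]
      exact mul_nonneg (mul_nonneg hα (Real.rpow_nonneg (by linarith) _))
        (hw0 τ ⟨hτ.1, hτt.le⟩)
    have h2 : 0 ≤ (t - s) ^ (-α) * w s :=
      mul_nonneg (Real.rpow_nonneg (by linarith) _) (hw0 s ⟨le_rfl, hst.le⟩)
    have hwc : ∫ τ in c..t, deriv w τ = -w c := by
      rw [(hw.mono hct).integral_deriv_eq_sub, hwt, zero_sub]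
    have h3 : (t - c) ^ (-α) * w c ≤ ∫ τ in c..t, (t - τ) ^ (-α) * |deriv w τ| := by
      have : (t - c) ^ (-α) * w c = ∫ τ in c..t, (t - c) ^ (-α) * (-deriv w τ) := by
        rw [intervalIntegral.integral_const_mul, intervalIntegral.integral_neg, hwc, neg_neg]
      rw [this]
      refine intervalIntegral.integral_mono_on_of_le_Ioo hc.2.le
        ((hw.mono hct).intervalIntegrable_deriv.neg.const_mul _) (habs.mono_set hct) ?_
      intro τ hτ
      refine (mul_le_mul_of_nonneg_left (neg_le_abs _)
        (Real.rpow_nonneg (by linarith [hc.2]) _)).trans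
        (mul_le_mul_of_nonneg_right ?_ (abs_nonneg _))
      exact Real.rpow_le_rpow_of_nonpos (by linarith [hτ.2]) (by linarith [hτ.1]) (by linarith)
    have h4 := intervalIntegral.integral_add_adjacent_intervals (habs.mono_set hsc)
      (habs.mono_set hct)
    linarith
  -- Let `c → t`: both primitives are continuous, and the bound in `key` tends to zero.
  have hF := intervalIntegral.continuousOn_primitive_interval' hint (a := s) left_mem_uIcc
  have hG := intervalIntegral.continuousOn_primitive_interval' habs (a := s) left_mem_uIcc
  rw [uIcc_of_le hst.le] at hF hG
  have ht : t ∈ Icc s t := ⟨hst.le, le_rfl⟩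
  have hcl : t ∈ closure (Ico s t) := by rw [closure_Ico hst.ne]; exact ht
  have := ContinuousWithinAt.closure_le hcl ((hF t ht).mono Ico_subset_Icc_self)
    ((continuousWithinAt_const (b := ∫ τ in s..t, (t - τ) ^ (-α) * |deriv w τ|)).sub
      ((hG t ht).mono Ico_subset_Icc_self)) key
  simpa using this

theorem intervalIntegrable_sub_rpow_neg {α : ℝ} (hα : α < 1) (s t : ℝ) :
    IntervalIntegrable (fun τ => (t - τ) ^ (-α)) volume s t := by
  have h := (intervalIntegral.intervalIntegrable_rpow' (a := t - s) (b := 0)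
    (show -1 < -α by linarith)).comp_sub_left t
  simpa using h

theorem integral_sub_rpow_neg {α : ℝ} (hα : α < 1) (s t : ℝ) :
    ∫ τ in s..t, (t - τ) ^ (-α) = (t - s) ^ (1 - α) / (1 - α) := by
  rw [intervalIntegral.integral_comp_sub_left (fun x => x ^ (-α)) t,
    integral_rpow (Or.inl (by linarith)), sub_self, Real.zero_rpow (by linarith)]
  rw [sub_zero, show -α + 1 = 1 - α by ring]

/-- Comparison of weighted integrals of derivatives at a touching point. -/
theorem integral_rpow_mul_deriv_le_of_touch {α s t : ℝ} {u v : ℝ → ℝ} (hα₀ : 0 ≤ α) (hα₁ : α < 1)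
    (hst : s < t) (hu : ContDiff ℝ 1 u) (hv : AbsolutelyContinuousOnInterval v s t)
    (hvu : ∀ τ ∈ Icc s t, v τ ≤ u τ) (ht : v t = u t)
    (hint : IntervalIntegrable (fun τ => (t - τ) ^ (-α) * deriv v τ) volume s t) :
    ∫ τ in s..t, (t - τ) ^ (-α) * deriv u τ ≤ ∫ τ in s..t, (t - τ) ^ (-α) * deriv v τ := by
  have huint : IntervalIntegrable (fun τ => (t - τ) ^ (-α) * deriv u τ) volume s t :=
    (intervalIntegrable_sub_rpow_neg hα₁ s t).mul_continuousOn
      (hu.continuous_deriv le_rfl).continuousOn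
  have hae : ∀ᵐ τ, τ ∈ uIoc s t → (t - τ) ^ (-α) * deriv u τ - (t - τ) ^ (-α) * deriv v τ =
      (t - τ) ^ (-α) * deriv (fun x => u x - v x) τ := by
    filter_upwards [hv.ae_differentiableAt] with τ hd hτ
    rw [deriv_fun_sub (hu.differentiable one_ne_zero τ) (hd (uIoc_subset_uIcc hτ)), mul_sub]
  have h := integral_rpow_mul_deriv_nonpos hα₀ hst
    (hu.contDiffOn.absolutelyContinuousOnInterval.fun_sub hv)
    (fun τ hτ => sub_nonneg.2 (hvu τ hτ)) (by simp [ht])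
    ((huint.sub hint).congr_ae ((ae_restrict_iff' measurableSet_uIoc).2 hae))
  rw [← intervalIntegral.integral_congr_ae hae, intervalIntegral.integral_sub huint hint] at h
  linarith

theorem lowerTerminal_lt {t₀ ω t : ℝ} (hω : 0 < ω) (ht : t₀ < t) : lowerTerminal t₀ ω t < t := by
  unfold lowerTerminal; split_ifs <;> linarith

theorem le_lowerTerminal (t₀ ω t : ℝ) : t₀ ≤ lowerTerminal t₀ ω t := by
  unfold lowerTerminal; split_ifs <;> linarith

theorem sub_le_lowerTerminal (t₀ ω t : ℝ) : t - ω ≤ lowerTerminal t₀ ω t := by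
  unfold lowerTerminal; split_ifs <;> linarith

/-- Lower bound for the short memory derivative of a decaying exponential. -/
theorem le_fracDeriv_exp {α ω t₀ μ K t : ℝ} (hα₁ : α < 1) (hω : 0 < ω) (hμ : 0 ≤ μ) (hK : 0 ≤ K)
    (ht : t₀ < t) :
    -(μ * Real.exp (μ * ω) * (1 / Real.Gamma (1 - α) * (ω ^ (1 - α) / (1 - α)))) *
      (K * Real.exp (-(μ * (t - t₀)))) ≤
      fracDeriv α ω t₀ (fun τ => K * Real.exp (-(μ * (τ - t₀)))) t := by
  set s := lowerTerminal t₀ ω t with hs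
  have hst : s < t := lowerTerminal_lt hω ht
  have hsω : t - ω ≤ s := sub_le_lowerTerminal t₀ ω t
  have hG : 0 < Real.Gamma (1 - α) := Real.Gamma_pos_of_pos (by linarith)
  have hd : deriv (fun τ => K * Real.exp (-(μ * (τ - t₀)))) =
      fun τ => -μ * (K * Real.exp (-(μ * (τ - t₀)))) := by
    funext τ
    have h := (((((hasDerivAt_id τ).sub_const t₀).const_mul μ).fun_neg).exp).const_mul K
    refine (h.congr_deriv ?_).deriv
    simp only [id]; ring
  have hk := intervalIntegrable_sub_rpow_neg hα₁ s t
  set B := -(μ * (K * (Real.exp (μ * ω) * Real.exp (-(μ * (t - t₀)))))) with hB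
  have hBn : B ≤ 0 := by rw [hB, neg_nonpos]; positivity
  -- On the window `τ ≥ t - ω`, so the exponential is at most `exp (μ * ω)` times its value at `t`.
  have h1 : ∫ τ in s..t, (t - τ) ^ (-α) * B ≤
      ∫ τ in s..t, (t - τ) ^ (-α) * (-μ * (K * Real.exp (-(μ * (τ - t₀))))) := by
    refine intervalIntegral.integral_mono_on hst.le (hk.mul_const B)
      (hk.mul_continuousOn (by fun_prop)) fun τ hτ => ?_
    refine mul_le_mul_of_nonneg_left ?_ (Real.rpow_nonneg (by linarith [hτ.2]) _)
    rw [hB, neg_mul, neg_le_neg_iff, ← Real.exp_add]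
    have : -(μ * (τ - t₀)) ≤ μ * ω + -(μ * (t - t₀)) := by
      nlinarith [mul_nonneg hμ (show 0 ≤ ω - t + τ by linarith [hτ.1])]
    gcongr
  rw [intervalIntegral.integral_mul_const, integral_sub_rpow_neg hα₁] at h1
  have h2 : (t - s) ^ (1 - α) / (1 - α) ≤ ω ^ (1 - α) / (1 - α) := by
    have : 0 < 1 - α := by linarith
    have : 0 ≤ t - s := by linarith
    gcongr
    linarith
  have h3 := (mul_le_mul_of_nonpos_right h2 hBn).trans h1
  unfold fracDeriv
  rw [hd, ← hs]
  refine le_trans (le_of_eq ?_) (mul_le_mul_of_nonneg_left h3 (by positivity))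
  rw [hB]; ring

/-- A scalar fractional differential inequality forces exponential decay. -/
theorem lt_exp_of_fracDeriv_le {α ω t₀ l μ K : ℝ} {v : ℝ → ℝ} (hα₀ : 0 ≤ α) (hα₁ : α < 1)
    (hω : 0 < ω) (hμ : 0 ≤ μ)
    (hμl : μ * Real.exp (μ * ω) * (1 / Real.Gamma (1 - α) * (ω ^ (1 - α) / (1 - α))) < l)
    (hv : Admissible α ω t₀ v) (hvl : ∀ t, t₀ < t → fracDeriv α ω t₀ v t ≤ -l * v t)
    (hK : 0 < K) (hvK : v t₀ < K) (t : ℝ) (ht : t₀ ≤ t) :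
    v t < K * Real.exp (-(μ * (t - t₀))) := by
  by_contra! hcon
  set u : ℝ → ℝ := fun τ => K * Real.exp (-(μ * (τ - t₀))) with hu
  have huc : ContDiff ℝ 1 u := by fun_prop
  have hvc : ContinuousOn v (Icc t₀ t) := by
    have := (hv.absCont t ht).continuousOn
    rwa [uIcc_of_le ht] at this
  have hd : ContinuousOn (fun τ => v τ - u τ) (Icc t₀ t) := hvc.sub huc.continuous.continuousOn
  -- The least element of this compact set is the first contact time; it is not `t₀`, since `v t₀ <
  -- K = u t₀`.
  set A := Icc t₀ t ∩ (fun τ => v τ - u τ) ⁻¹' Ici 0 with hA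
  have hAc : IsCompact A :=
    isCompact_Icc.of_isClosed_subset (hd.preimage_isClosed_of_isClosed isClosed_Icc isClosed_Ici)
      inter_subset_left
  obtain ⟨r, hr⟩ := hAc.exists_isLeast ⟨t, ⟨ht, le_rfl⟩, sub_nonneg.2 hcon⟩
  have hr1 : u r ≤ v r := sub_nonneg.1 hr.1.2
  have hr0 : t₀ < r := by
    rcases hr.1.1.1.eq_or_lt with h | h
    · rw [← h] at hr1
      simp only [hu, sub_self, mul_zero, neg_zero, Real.exp_zero, mul_one] at hr1
      linarith
    · exact h
  have hlt : ∀ τ ∈ Ico t₀ r, v τ - u τ ≤ 0 := by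
    intro τ hτ
    by_contra! h
    exact absurd (hr.2 ⟨⟨hτ.1, hτ.2.le.trans hr.1.1.2⟩, h.le⟩) (not_le.2 hτ.2)
  have hr2 : v r - u r ≤ 0 := by
    have hcl : r ∈ closure (Ico t₀ r) := by rw [closure_Ico hr0.ne]; exact ⟨hr0.le, le_rfl⟩
    exact ContinuousWithinAt.closure_le hcl
      ((hd r hr.1.1).mono fun τ hτ => ⟨hτ.1, hτ.2.le.trans hr.1.1.2⟩) continuousWithinAt_const hlt
  have heq : v r = u r := le_antisymm (sub_nonpos.1 hr2) hr1
  have hsr := lowerTerminal_lt hω hr0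
  have h0s := le_lowerTerminal t₀ ω r
  have hcomp : fracDeriv α ω t₀ u r ≤ fracDeriv α ω t₀ v r := by
    unfold fracDeriv
    refine mul_le_mul_of_nonneg_left ?_
      (one_div_nonneg.2 (Real.Gamma_pos_of_pos (by linarith)).le)
    refine integral_rpow_mul_deriv_le_of_touch hα₀ hα₁ hsr huc
      ((hv.absCont r hr0.le).mono ?_) ?_ heq (hv.integrable r hr0)
    · rw [uIcc_of_le hsr.le, uIcc_of_le hr0.le]
      exact Icc_subset_Icc_left h0s
    · intro τ hτ
      rcases hτ.2.eq_or_lt with h | h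
      · rw [h, heq]
      · exact sub_nonpos.1 (hlt τ ⟨h0s.trans hτ.1, h⟩)
  have hlow := le_fracDeriv_exp (t₀ := t₀) hα₁ hω hμ hK.le hr0
  have hup := hvl r hr0
  rw [heq] at hup
  have hur : 0 < u r := by simp only [hu]; positivity
  have := mul_lt_mul_of_pos_right hμl hur
  change _ * u r ≤ fracDeriv α ω t₀ u r at hlow
  linarith

/-- The left side is continuous in `μ` and vanishes at `μ = 0`. -/
theorem exists_pos_mul_exp_mul_lt {l : ℝ} (hl : 0 < l) (ω C : ℝ) :
    ∃ μ > 0, μ * Real.exp (μ * ω) * C < l := by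
  have hc : Continuous fun μ : ℝ => μ * Real.exp (μ * ω) * C := by fun_prop
  have h : ∀ᶠ μ in 𝓝 (0 : ℝ), μ * Real.exp (μ * ω) * C < l :=
    hc.continuousAt.eventually_lt continuousAt_const (by simpa using hl)
  have h' : ∀ᶠ μ in 𝓝[>] (0 : ℝ), μ * Real.exp (μ * ω) * C < l := h.filter_mono nhdsWithin_le_nhds
  obtain ⟨μ, h1, h2⟩ := (h'.and self_mem_nhdsWithin).exists
  exact ⟨μ, h2, h1⟩

theorem theorem4 {n : ℕ} (α ω t₀ : ℝ) (hα₀ : 0 < α) (hα₁ : α < 1) (hω : 0 < ω)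
    (f : EuclideanSpace ℝ (Fin n) → ℝ → EuclideanSpace ℝ (Fin n))
    (hf : ContinuousOn (fun p : EuclideanSpace ℝ (Fin n) × ℝ => f p.1 p.2)
      (Set.univ ×ˢ Set.Ici t₀))
    (heq : ShortMemory.IsEquilibrium t₀ f 0)
    (V : ℝ → EuclideanSpace ℝ (Fin n) → ℝ) (l : ℝ) (φ₁ φ₂ : ℝ≥0 → ℝ≥0)
    (hφ₁ : ShortMemory.IsClassK φ₁) (hφ₂ : ShortMemory.IsClassK φ₂)
    (hl : 0 < l)
    (hV : ∀ t, t₀ ≤ t → ∀ x, (φ₁ ‖x‖₊ : ℝ) ≤ V t x ∧ V t x ≤ (φ₂ ‖x‖₊ : ℝ))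
    (hVadm : ∀ x, ShortMemory.IsSolution α ω t₀ f x →
      ShortMemory.Admissible α ω t₀ (fun t => V t (x t)))
    (hVderiv : ∀ x, ShortMemory.IsSolution α ω t₀ f x → ∀ t, t₀ < t →
      ShortMemory.fracDeriv α ω t₀ (fun τ => V τ (x τ)) t ≤ -l * V t (x t))
    (hlω : 1 / (ω ^ α * Real.Gamma (1 - α)) < l) :
    ShortMemory.IsAsymptoticallyStable α ω t₀ f 0 := by
  obtain ⟨μ, hμ, hμl⟩ := exists_pos_mul_exp_mul_lt hl ω
    (1 / Real.Gamma (1 - α) * (ω ^ (1 - α) / (1 - α)))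
  have decay : ∀ x, IsSolution α ω t₀ f x → ∀ K : ℝ, 0 < K → V t₀ (x t₀) < K → ∀ t, t₀ ≤ t →
      V t (x t) < K * Real.exp (-(μ * (t - t₀))) := fun x hx K hK hxK =>
    lt_exp_of_fracDeriv_le hα₀.le hα₁ hω hμ.le hμl (hVadm x hx) (hVderiv x hx) hK hxK
  have small : ∀ (t : ℝ) (y : EuclideanSpace ℝ (Fin n)) (ε : ℝ), t₀ ≤ t → 0 < ε →
      V t y < φ₁ ε.toNNReal → ‖y‖ < ε := by
    intro t y ε ht hε h
    have h1 : φ₁ ‖y‖₊ < φ₁ ε.toNNReal := by exact_mod_cast (hV t ht y).1.trans_lt h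
    exact (Real.lt_toNNReal_iff_coe_lt).1 (hφ₁.strictMono.lt_iff_lt.1 h1)
  have pos : ∀ ε : ℝ, 0 < ε → (0 : ℝ) < φ₁ ε.toNNReal := by
    intro ε hε
    have := hφ₁.strictMono (Real.toNNReal_pos.2 hε)
    rw [hφ₁.map_zero] at this
    exact_mod_cast this
  -- The radius `1` is arbitrary: the decay holds from every initial value.
  refine ⟨fun ε hε => ?_, 1, one_pos, fun x hx _ => ?_⟩
  -- Stability uses the decay estimate with `K = φ₁ ε`; `δ` is chosen so that `φ₂ ‖x t₀‖ < φ₁ ε`.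
  · have hev : ∀ᶠ y in 𝓝 (0 : EuclideanSpace ℝ (Fin n)), φ₂ ‖y‖₊ < φ₁ ε.toNNReal := by
      refine (hφ₂.continuous.comp continuous_nnnorm).continuousAt.eventually_lt
        continuousAt_const ?_
      simpa [hφ₂.map_zero] using pos ε hε
    obtain ⟨δ, hδ, hball⟩ := Metric.eventually_nhds_iff.1 hev
    refine ⟨δ, hδ, fun x hx hxδ t ht => ?_⟩
    rw [sub_zero] at hxδ ⊢
    refine small t (x t) ε ht hε ?_
    have h0 : V t₀ (x t₀) < φ₁ ε.toNNReal :=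
      (hV t₀ le_rfl _).2.trans_lt (by exact_mod_cast hball (by rwa [dist_zero_right]))
    refine (decay x hx _ (pos ε hε) h0 t ht).trans_le ?_
    refine mul_le_of_le_one_right (pos ε hε).le (Real.exp_le_one_iff.2 ?_)
    have := mul_nonneg hμ.le (sub_nonneg.2 ht)
    linarith
  -- The maximum with `0` keeps `K` positive even when `V` vanishes initially.
  · obtain ⟨K, hK⟩ := exists_gt (max 0 (V t₀ (x t₀)))
    rw [max_lt_iff] at hK
    have hlim : Tendsto (fun t => K * Real.exp (-(μ * (t - t₀)))) atTop (𝓝 0) := by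
      have h : Tendsto (fun t => μ * (t - t₀)) atTop atTop :=
        (tendsto_atTop_add_const_right _ (-t₀) tendsto_id).const_mul_atTop hμ
      simpa using (Real.tendsto_exp_neg_atTop_nhds_zero.comp h).const_mul K
    rw [Metric.tendsto_nhds]
    intro ε hε
    filter_upwards [hlim.eventually_lt_const (pos ε hε), eventually_ge_atTop t₀] with t h1 ht
    rw [dist_zero_right]
    exact small t (x t) ε ht hε ((decay x hx K hK.1 hK.2 t ht).trans h1)
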